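/- Self-delimiting machines. A self-delimiting machine has a one-way read-only program tape, a work memory, initially blank, that evolves by a computable rule, and a one-way write-only binary output tape. For $p,x\in\{0,1\}^*$, $T(p)=x$ means that $T$, started with $p$ on the program tape, halts after having scanned exactly the bits of $p$, with $x$ on the output tape; then $T(p)$ is said to be defined. A program $p$ makes $T$ computably enumerate a set $S\subseteq\{0,1\}^*$ if $T$ scans all of $p$, never asks for a further bit, and (in a computation that may run forever) writes on its output tape, one after another, in any order and possibly with repetitions, the self-delimiting encodings $\bar s=1^{|s|}0s$ of all the elements $s$ of $S$ and of no other strings. Let $U$ be a universal self-delimiting machine: for every self-delimiting machine $T$ there is a string $r$ such that, for all $q$, $U$ on the program $rq$ computes the same value (if any) and enumerates the same set (if any) as $T$ on $q$. Let $$\Omega=\sum_{p\,:\,U(p)\text{ is defined}}2^{-|p|}$$ be the halting probability of $U$. Theories. A formal axiomatic theory $\mathcal A$ is a computably enumerable set of assertions (its theorems), written as binary strings. Its complexity $K(\mathcal A)$ is the length of a shortest program that makes $U$ computably enumerate the theorems of $\mathcal A$. Fix a computable injective map $(n,b)\mapsto\ulcorner\Omega_n=b\urcorner\in\{0,1\}^*$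 that expresses, as a string, the assertion that the $n$-th binary digit of $\Omega$ is $b$ ($b\in\{0,1\}$). The theory $\mathcal A$ determines the $n$-th bit of $\Omega$ if $\ulcorner\Omega_n=b\urcorner$ is a theorem of $\mathcal A$ for some $b$. Theorem (Chaitin). There is a constant $c$ (depending only on $U$ and on the map $\ulcorner\cdot\urcorner$) such that every formal axiomatic theory $\mathcal A_0$ that proves no false assertion of the form $\ulcorner\Omega_n=b\urcorner$ determines at most $K(\mathcal A_0)+c$ bits of $\Omega$, at whatever positions, consecutive or not. -/

import Mathlib

/-- A self-delimiting machine. It has a one-way read-only program tape, a one-way write-only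
binary output tape, and an internal memory. The contents of the work tape and the state of the
finite control together form the internal configuration, which is coded by a natural number and
evolves by a computable rule. At the start the internal configuration is `start`, the output tape
is empty, and no bit of the program has been scanned. -/
structure SelfDelimitingMachine where
  /-- the initial internal configuration (blank work tape) -/
  start : ℕ
  /-- the internal configurations in which the machine halts -/
  halts : ℕ → Bool
  /-- the internal configurations in which the next step scans the next bit of the program -/
  scans : ℕ → Bool
  /-- the next internal configuration, given the bit that was scanned in this step, if any -/
  next : ℕ → Option Bool → ℕ
  /-- the bit that is written on the output tape in this step, if any -/
  writes : ℕ → Option Bool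
  computable_halts : Computable halts
  computable_scans : Computable scans
  computable_next : Computable₂ next
  computable_writes : Computable writes

namespace SelfDelimitingMachine

/-- A complete configuration: internal configuration, the part of the program tape that has not
been scanned yet, and the contents of the output tape. -/
structure Config where
  internal : ℕ
  unread : List Bool
  output : List Bool

/-- In this configuration the machine asks for one more bit of the program, but all bits of the
program have been scanned already. -/
def Overshoots (M : SelfDelimitingMachine) (C : Config) : Prop :=
  M.halts C.internal = false ∧ M.scans C.internal = true ∧ C.unread = []

/-- One step of the machine. A machine that has halted does nothing, and neither does a machine
that asks for a bit after the end of the program. -/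
def step (M : SelfDelimitingMachine) (C : Config) : Config :=
  if M.halts C.internal then C
  else if M.scans C.internal then
    match C.unread with
    | [] => C
    | b :: rest =>
      ⟨M.next C.internal (some b), rest, C.output ++ (M.writes C.internal).toList⟩
  else ⟨M.next C.internal none, C.unread, C.output ++ (M.writes C.internal).toList⟩

/-- The configuration after `t` steps on program `p`. -/
def run (M : SelfDelimitingMachine) (p : List Bool) (t : ℕ) : Config :=
  M.step^[t] ⟨M.start, p, []⟩

/-- `M(p) = x`: on program `p` the machine halts, having scanned exactly `p`, and the output tape
contains `x`. -/
def Computes (M : SelfDelimitingMachine) (p x : List Bool) : Prop :=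
  ∃ t, M.halts (M.run p t).internal = true ∧ (M.run p t).unread = [] ∧ (M.run p t).output = x

/-- `M(p)` is defined. -/
def HaltsOn (M : SelfDelimitingMachine) (p : List Bool) : Prop :=
  ∃ x, M.Computes p x

end SelfDelimitingMachine

/-- The self-delimiting encoding `1^|x| 0 x` of a string `x`. -/
def selfDelim (x : List Bool) : List Bool :=
  List.replicate x.length true ++ false :: x

namespace SelfDelimitingMachine

/-- The program `p` makes `M` computably enumerate the set `S` of strings: `M` scans all of `p`,
never asks for a further bit, and writes on its output tape, one after another and each in
self-delimiting encoding, all the elements of `S` and nothing else (in any order, possibly with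
repetitions). In general this computation does not halt. -/
def Enumerates (M : SelfDelimitingMachine) (p : List Bool) (S : Set (List Bool)) : Prop :=
  (∃ t, (M.run p t).unread = []) ∧
  (∀ t, ¬ M.Overshoots (M.run p t)) ∧
  ∀ s, s ∈ S ↔ ∃ (t : ℕ) (l : List (List Bool)),
    l.flatMap selfDelim ++ selfDelim s <+: (M.run p t).output

/-- `U` is a universal self-delimiting machine: each self-delimiting machine `T` has a header `r`
such that `U` on `r q` does what `T` does on `q`, for all `q`, both for the computations that halt
and for the enumerations, which may run forever. -/
def IsUniversal (U : SelfDelimitingMachine) : Prop :=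
  ∀ T : SelfDelimitingMachine, ∃ r : List Bool, ∀ q : List Bool,
    (∀ x, U.Computes (r ++ q) x ↔ T.Computes q x) ∧
    (∀ S, U.Enumerates (r ++ q) S ↔ T.Enumerates q S)

/-- The halting probability `Ω` of `U`: the sum of `2 ^ (-|p|)` over all `p` on which `U` halts. -/
noncomputable def haltingProbability (U : SelfDelimitingMachine) : ℝ :=
  ∑' p : {p : List Bool // U.HaltsOn p}, (1 / 2 : ℝ) ^ (p : List Bool).length

/-- The binary digits of `Ω` after the binary point: `U.omegaBit 0` is the first one. -/
noncomputable def omegaBit (U : SelfDelimitingMachine) (n : ℕ) : Fin 2 :=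
  Real.digits U.haltingProbability 2 n

end SelfDelimitingMachine

/-- A formal axiomatic theory, given by its theorems: a computably enumerable set of assertions,
which are strings. -/
structure FormalAxiomaticTheory where
  theorems : Set (List Bool)
  enumerable : REPred fun s => s ∈ theorems

namespace FormalAxiomaticTheory

/-- The complexity `K(A)`: the length of a shortest program for `U` that computably enumerates the
theorems of `A`. -/
noncomputable def complexity (U : SelfDelimitingMachine) (A : FormalAxiomaticTheory) : ℕ∞ :=
  ⨅ (p : List Bool) (_ : U.Enumerates p A.theorems), (p.length : ℕ∞)

/-- `A` proves no false assertion about the bits of `Ω`. Here `assertion (n, b)` is the string that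
expresses that bit `n` of `Ω` is `b`. -/
def SoundForOmega (U : SelfDelimitingMachine) (assertion : ℕ × Fin 2 → List Bool)
    (A : FormalAxiomaticTheory) : Prop :=
  ∀ n b, assertion (n, b) ∈ A.theorems → U.omegaBit n = b

/-- The positions `n` (not necessarily consecutive) at which `A` proves what the bit of `Ω` is. -/
def determinedBits (assertion : ℕ × Fin 2 → List Bool) (A : FormalAxiomaticTheory) : Set ℕ :=
  {n | ∃ b, assertion (n, b) ∈ A.theorems}

end FormalAxiomaticTheory

/-! Knowing the integer part `a` of `2^N * Ω` is enough to compute a string that no program with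
fewer than `N` bits computes. Run all programs until those that have halted have total weight above
`(a - 1) / 2^N`. A program with fewer than `N` bits that halts later would add at least `2 / 2^N`
and push the sum above `(a + 1) / 2^N > Ω`. So a string longer than all outputs produced so far has
no such program (`exists_mem_complexString`).

A theory that determines too many bits would compress such a string. Let `p` enumerate its theorems,
and let at least `|p| + 2j` bits be determined. At some step of the enumeration sufficiently many
values have appeared (`Enumerates.exists_certificateAt`). Let `v` be the part of `p` scanned by
then, let the first `N` positions contain `k ≥ |v| + 2j` positions with a value, and let `rest` list
the other `N - k` bits. By soundness the values and `rest` together give the integer part of `2^N *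
Ω` (`fill_missingBits`), so a machine `T` obtains the complex string from `1^j 0 v rest`, which has
at most `N - j + 1` bits (`exists_machine_compressing`). If `r` is the header of `T`, then `j = |r|
+ 2` yields a program for `U` with at most `N - 1` bits, a contradiction. The header depends on `T`,
so `j` cannot be built into `T`; its unary code costs `j + 1` bits, whence the surplus `2j`.

`T` must also be self-delimiting: from what it has read, it has to decide whether a further bit is
needed (`none_mem_complexStringOfProgram_of_proper`). `exists_machine_of_partrec` turns an algorithm
of this kind into a machine. -/

namespace SelfDelimitingMachine

/-! ### Runs of a machine on a program and on its prefixes -/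

variable (M : SelfDelimitingMachine)

theorem run_zero (p : List Bool) : M.run p 0 = ⟨M.start, p, []⟩ := rfl

theorem run_succ (p : List Bool) (t : ℕ) : M.run p (t + 1) = M.step (M.run p t) :=
  Function.iterate_succ_apply' ..

theorem run_add (p : List Bool) (s t : ℕ) : M.run p (s + t) = M.step^[t] (M.run p s) := by
  rw [run, add_comm, Function.iterate_add_apply]; rfl

theorem run_add_of_fixed {p : List Bool} {s : ℕ} (h : M.step (M.run p s) = M.run p s) (t : ℕ) :
    M.run p (s + t) = M.run p s := by
  rw [run_add]; exact Function.iterate_fixed h t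

theorem step_of_halts {C : Config} (h : M.halts C.internal = true) : M.step C = C := by
  simp [step, h]

theorem step_of_overshoots {C : Config} (h : M.Overshoots C) : M.step C = C := by
  obtain ⟨h1, h2, h3⟩ := h
  simp [step, h1, h2, h3]

theorem run_eq_of_halts {p : List Bool} {s t : ℕ} (hs : M.halts (M.run p s).internal = true)
    (hst : s ≤ t) : M.run p t = M.run p s := by
  obtain ⟨k, rfl⟩ := Nat.exists_eq_add_of_le hst
  exact M.run_add_of_fixed (M.step_of_halts hs) k

theorem run_eq_run_of_halts {p : List Bool} {s t : ℕ} (hs : M.halts (M.run p s).internal = true)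
    (ht : M.halts (M.run p t).internal = true) : M.run p t = M.run p s := by
  rcases le_total s t with h | h
  · exact M.run_eq_of_halts hs h
  · exact (M.run_eq_of_halts ht h).symm

theorem not_overshoots_of_halts {p : List Bool} {s t : ℕ}
    (ht : M.halts (M.run p t).internal = true) (hst : s < t) : ¬ M.Overshoots (M.run p s) := by
  intro h
  obtain ⟨k, rfl⟩ := Nat.exists_eq_add_of_le hst.le
  rw [M.run_add_of_fixed (M.step_of_overshoots h), h.1] at ht
  exact Bool.false_ne_true ht

theorem Computes.output_unique {M : SelfDelimitingMachine} {p x y : List Bool}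
    (hx : M.Computes p x) (hy : M.Computes p y) : x = y := by
  obtain ⟨s, hs, -, rfl⟩ := hx
  obtain ⟨t, ht, -, rfl⟩ := hy
  rw [M.run_eq_run_of_halts hs ht]

theorem step_suffix (C : Config) : (M.step C).unread <:+ C.unread := by
  unfold step
  split_ifs
  · exact List.suffix_rfl
  · split
    · exact List.suffix_rfl
    · rename_i h; rw [h]; exact List.suffix_cons _ _
  · exact List.suffix_rfl

theorem step_prefix (C : Config) : C.output <+: (M.step C).output := by
  unfold step
  split_ifs
  · exact List.prefix_rfl
  · split
    · exact List.prefix_rfl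
    · exact List.prefix_append _ _
  · exact List.prefix_append _ _

theorem unread_suffix (p : List Bool) {s t : ℕ} (h : s ≤ t) :
    (M.run p t).unread <:+ (M.run p s).unread := by
  induction t, h using Nat.le_induction with
  | base => exact List.suffix_rfl
  | succ t _ ih => rw [run_succ]; exact (M.step_suffix _).trans ih

theorem output_prefix (p : List Bool) {s t : ℕ} (h : s ≤ t) :
    (M.run p s).output <+: (M.run p t).output := by
  induction t, h using Nat.le_induction with
  | base => exact List.prefix_rfl
  | succ t _ ih => rw [run_succ]; exact ih.trans (M.step_prefix _)

/-- Only a request for a bit beyond the end can distinguish a program from its extensions. -/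
theorem step_append {C : Config} (h : ¬ M.Overshoots C) (u : List Bool) :
    M.step ⟨C.internal, C.unread ++ u, C.output⟩ =
      ⟨(M.step C).internal, (M.step C).unread ++ u, (M.step C).output⟩ := by
  obtain ⟨i, v, o⟩ := C
  by_cases h1 : M.halts i
  · simp [step, h1]
  by_cases h2 : M.scans i
  · cases v with
    | nil => exact absurd ⟨by simpa using h1, h2, rfl⟩ h
    | cons b v => simp [step, h1, h2]
  · simp [step, h1, h2]

/-- A machine that has not asked for more bits than `v` has works on `v ++ u` as on `v`. -/
theorem run_append {v : List Bool} {s : ℕ} (h : ∀ t < s, ¬ M.Overshoots (M.run v t))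
    (u : List Bool) :
    M.run (v ++ u) s = ⟨(M.run v s).internal, (M.run v s).unread ++ u, (M.run v s).output⟩ := by
  induction s with
  | zero => rfl
  | succ s ih =>
    rw [run_succ, ih fun t ht => h t (ht.trans s.lt_succ_self), M.step_append (h s s.lt_succ_self),
      run_succ]

/-- If `p` is never too short, then neither is the part of `p` scanned within `s` steps, during
these steps. -/
theorem not_overshoots_of_append {v u : List Bool} {s : ℕ}
    (hp : ∀ t < s, ¬ M.Overshoots (M.run (v ++ u) t)) (hs : (M.run (v ++ u) s).unread = u) :
    ∀ t < s, ¬ M.Overshoots (M.run v t) := by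
  intro t
  induction t using Nat.strong_induction_on with
  | _ t ih =>
    intro ht ho
    have hrun := M.run_append (s := t) (fun k hk => ih k hk (hk.trans ht)) u
    obtain ⟨h1, h2, h3⟩ := ho
    rw [h3, List.nil_append] at hrun
    cases u with
    | nil => exact hp t ht ⟨by rw [hrun]; exact h1, by rw [hrun]; exact h2, by rw [hrun]⟩
    | cons b u =>
      -- The next step consumes `b`, which would have to be unread again at step `s`.
      have hsuc : (M.run (v ++ b :: u) (t + 1)).unread = u := by
        rw [run_succ, hrun]; simp [step, h1, h2]
      have := (M.unread_suffix (v ++ b :: u) ht).length_le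
      rw [Nat.succ_eq_add_one, hsuc, hs] at this
      simp at this

/-- The programs on which a machine halts form a prefix-free set. -/
theorem HaltsOn.append_eq_nil {M : SelfDelimitingMachine} {p u : List Bool} (hp : M.HaltsOn p)
    (hu : M.HaltsOn (p ++ u)) : u = [] := by
  obtain ⟨_, t, ht, hr, -⟩ := hp
  obtain ⟨_, s, hs, hr', -⟩ := hu
  have hrun := M.run_append (fun k hk => M.not_overshoots_of_halts ht hk) u
  have := M.run_eq_run_of_halts hs (t := t) (by rw [hrun]; exact ht)
  rw [← this, hrun, hr] at hr'
  exact hr'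

end SelfDelimitingMachine

/-! ### Convergence of the series for `Ω` -/

/-- A set of nonempty strings none of which is a proper prefix of another one is uniquely
decodable. -/
theorem uniquelyDecodable_of_prefixFree {α : Type*} {S : Set (List α)} (h0 : [] ∉ S)
    (h : ∀ p u, p ∈ S → p ++ u ∈ S → u = []) : InformationTheory.UniquelyDecodable S := by
  intro L₁
  induction L₁ with
  | nil =>
    rintro (_ | ⟨y, L₂⟩) - h2 he
    · rfl
    · have : y = [] := by simp at he; exact he.1
      exact absurd (this ▸ h2 y (by simp)) h0
  | cons x L₁ ih =>
    rintro (_ | ⟨y, L₂⟩) h1 h2 he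
    · have : x = [] := by simp at he; exact he.1
      exact absurd (this ▸ h1 x (by simp)) h0
    · have hx := h1 x (by simp)
      have hy := h2 y (by simp)
      rw [List.flatten_cons, List.flatten_cons] at he
      have hxy : x = y := by
        rcases List.append_eq_append_iff.1 he with ⟨u, rfl, -⟩ | ⟨u, rfl, -⟩
        · simp [h x u hx hy]
        · simp [h y u hy hx]
      subst hxy
      rw [ih L₂ (fun w hw => h1 w (by simp [hw])) (fun w hw => h2 w (by simp [hw]))
        (List.append_cancel_left he)]

namespace SelfDelimitingMachine

variable (M : SelfDelimitingMachine)

theorem summable_haltingProbability :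
    Summable fun p : {p : List Bool // M.HaltsOn p} => (1 / 2 : ℝ) ^ (p : List Bool).length := by
  -- Unique decodability excludes the empty string. If the machine halts on it, prefix-freeness
  -- leaves no other program.
  by_cases h0 : M.HaltsOn []
  · have : Subsingleton {p : List Bool // M.HaltsOn p} :=
      ⟨fun p q => Subtype.ext ((h0.append_eq_nil p.2).trans (h0.append_eq_nil q.2).symm)⟩
    exact Summable.of_finite
  · refine summable_of_sum_le (c := 1) (fun _ => by positivity) fun F => ?_
    have := InformationTheory.kraft_mcmillan_inequality
      (S := F.map (Function.Embedding.subtype _)) (α := Bool)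
      (uniquelyDecodable_of_prefixFree (by simpa using fun h => absurd h h0) fun p u hp hu => by
        simp only [Finset.coe_map, Function.Embedding.subtype_apply, Set.mem_image] at hp hu
        obtain ⟨p', -, rfl⟩ := hp
        obtain ⟨u', -, hu'⟩ := hu
        exact p'.2.append_eq_nil (hu' ▸ u'.2))
    simpa using this

theorem haltingProbability_nonneg : 0 ≤ M.haltingProbability :=
  tsum_nonneg fun _ => by positivity

theorem sum_le_haltingProbability (F : Finset (List Bool)) (hF : ∀ p ∈ F, M.HaltsOn p) :
    ∑ p ∈ F, (1 / 2 : ℝ) ^ p.length ≤ M.haltingProbability := by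
  classical
  have := M.summable_haltingProbability.sum_le_tsum (F.subtype M.HaltsOn)
    fun _ _ => by positivity
  rwa [Finset.sum_subtype_of_mem (fun p : List Bool => (1 / 2 : ℝ) ^ p.length) hF] at this

theorem exists_lt_sum (r : ℝ) (hr : r < M.haltingProbability) :
    ∃ F : Finset (List Bool), (∀ p ∈ F, M.HaltsOn p) ∧ r < ∑ p ∈ F, (1 / 2 : ℝ) ^ p.length := by
  obtain ⟨F, hF⟩ := (M.summable_haltingProbability.hasSum.eventually_const_lt hr).exists
  refine ⟨F.map (Function.Embedding.subtype _), fun p hp => ?_, by simpa using hF⟩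
  simp only [Finset.mem_map, Function.Embedding.subtype_apply] at hp
  obtain ⟨p', -, rfl⟩ := hp
  exact p'.2

end SelfDelimitingMachine

/-! ### Self-delimiting machines for partial recursive functions -/

/-- A partial recursive function is the limit of computable approximations. -/
theorem Partrec.exists_stages {α σ : Type*} [Primcodable α] [Primcodable σ] {g : α →. σ}
    (hg : Partrec g) :
    ∃ f : α → ℕ → Option σ, Computable₂ f ∧ ∀ a y, y ∈ g a ↔ ∃ s, f a s = some y := by
  obtain ⟨c, hc⟩ := Nat.Partrec.Code.exists_code.1 hg
  refine ⟨fun a s => (c.evaln s (Encodable.encode a)).bind Encodable.decode, ?_, fun a y => ?_⟩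
  · exact Computable.option_bind
      (Nat.Partrec.Code.primrec_evaln.to_comp.comp
        ((Computable.snd.pair (Computable.const c)).pair (Computable.encode.comp Computable.fst)))
      (Computable.decode.comp Computable.snd)
  · have hev : c.eval (Encodable.encode a) = (g a).map Encodable.encode := by
      rw [hc]; simp
    constructor
    · intro hy
      have : Encodable.encode y ∈ c.eval (Encodable.encode a) := by
        rw [hev]; exact Part.mem_map _ hy
      obtain ⟨s, hs⟩ := Nat.Partrec.Code.evaln_complete.1 this
      exact ⟨s, by simp [Option.mem_def.1 hs]⟩
    · rintro ⟨s, hs⟩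
      obtain ⟨n, hn, hy⟩ := Option.bind_eq_some_iff.1 hs
      have := Nat.Partrec.Code.evaln_sound hn
      rw [hev, Part.mem_map_iff] at this
      obtain ⟨z, hz, rfl⟩ := this
      rw [Encodable.encodek, Option.some_inj] at hy
      exact hy ▸ hz

namespace SelfDelimitingMachine

/-- The machine whose internal configurations are coded elements of a type `σ`. -/
def ofTransitions {σ : Type*} [Primcodable σ] (start : σ) (halts scans : σ → Bool)
    (next : σ → Option Bool → σ) (writes : σ → Option Bool) (hh : Computable halts)
    (hs : Computable scans) (hn : Computable₂ next) (hw : Computable writes) :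
    SelfDelimitingMachine where
  start := Encodable.encode start
  -- The default values are irrelevant: the start and all its successors are codes of elements of
  -- `σ`.
  halts n := ((Encodable.decode (α := σ) n).map halts).getD false
  scans n := ((Encodable.decode (α := σ) n).map scans).getD false
  next n b := ((Encodable.decode (α := σ) n).map fun c => Encodable.encode (next c b)).getD 0
  writes n := ((Encodable.decode (α := σ) n).map writes).getD none
  computable_halts := Computable.option_getD
    (Computable.option_map Computable.decode (hh.comp Computable.snd)) (Computable.const _)
  computable_scans := Computable.option_getD
    (Computable.option_map Computable.decode (hs.comp Computable.snd)) (Computable.const _)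
  computable_next := Computable.option_getD
    (Computable.option_map (Computable.decode.comp Computable.fst)
      (Computable.encode.comp (hn.comp Computable.snd (Computable.snd.comp Computable.fst))))
    (Computable.const _)
  computable_writes := Computable.option_getD
    (Computable.option_map Computable.decode (hw.comp Computable.snd)) (Computable.const _)

/-- The internal configurations of the machine that works along the approximations `f`: the bits
scanned so far, the number of the approximation, and the output still to be written, if it is
known already. -/
abbrev StageConfig := List Bool × ℕ × Option (List Bool)

section Stages

variable (f : List Bool → ℕ → Option (Option (List Bool)))

/-- Whether the machine that works along `f` scans a bit. -/
def stageScans (c : StageConfig) : Bool :=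
  Option.casesOn c.2.2
    (Option.casesOn (f c.1 c.2.1) false fun y => Option.casesOn y true fun _ => false) fun _ => false

/-- The transition of the machine that works along `f`. -/
def stageNext (c : StageConfig) (o : Option Bool) : StageConfig :=
  Option.casesOn c.2.2
    (Option.casesOn o
      (Option.casesOn (f c.1 c.2.1) (c.1, c.2.1 + 1, none) fun y => (c.1, c.2.1, y))
      -- A scanned bit changes the argument, so the search for a value restarts at approximation
      -- `0`.
      fun b => (c.1 ++ [b], 0, none))
    fun x => (c.1, c.2.1, some x.tail)

/-- The bit that the machine that works along an approximation writes. -/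
def stageWrites (c : StageConfig) : Option Bool :=
  c.2.2.bind List.head?

/-- Whether the machine that works along an approximation has halted. -/
def stageHalts (c : StageConfig) : Bool :=
  decide (c.2.2 = some [])

variable {f}

theorem computable_stageScans (hf : Computable₂ f) : Computable (stageScans f) :=
  Computable.option_casesOn (Computable.snd.comp Computable.snd)
    (Computable.option_casesOn
      (hf.comp Computable.fst (Computable.fst.comp Computable.snd)) (Computable.const _)
      (Computable.option_casesOn Computable.snd (Computable.const _)
        (Computable.const false).to₂).to₂)
    (Computable.const false).to₂

theorem computable_stageNext (hf : Computable₂ f) : Computable₂ (stageNext f) := by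
  have h1 : Computable fun p : StageConfig × Option Bool => p.1.1 :=
    Computable.fst.comp Computable.fst
  have h2 : Computable fun p : StageConfig × Option Bool => p.1.2.1 :=
    Computable.fst.comp (Computable.snd.comp Computable.fst)
  have h3 : Computable fun p : StageConfig × Option Bool => p.1.2.2 :=
    Computable.snd.comp (Computable.snd.comp Computable.fst)
  exact Computable.option_casesOn h3
    (Computable.option_casesOn Computable.snd
      (Computable.option_casesOn (hf.comp h1 h2)
        (h1.pair ((Computable.succ.comp h2).pair (Computable.const _)))
        ((h1.comp Computable.fst).pair ((h2.comp Computable.fst).pair Computable.snd)).to₂)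
      ((Computable.list_concat.comp (h1.comp Computable.fst) Computable.snd).pair
        (Computable.const (0, none))).to₂)
    ((h1.comp Computable.fst).pair ((h2.comp Computable.fst).pair
      (Computable.option_some.comp (Primrec.list_tail.to_comp.comp Computable.snd)))).to₂

theorem computable_stageWrites : Computable stageWrites :=
  Computable.option_bind (Computable.snd.comp Computable.snd)
    (Primrec.list_head?.to_comp.comp Computable.snd)

theorem computable_stageHalts : Computable stageHalts :=
  (Primrec.eq.decide.comp (Primrec.snd.comp Primrec.snd) (Primrec.const (some []))).to_comp

/-- The machine that works along the approximations `f`. -/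
def ofStages (hf : Computable₂ f) : SelfDelimitingMachine :=
  ofTransitions ([], 0, none) stageHalts (stageScans f) (stageNext f) stageWrites
    computable_stageHalts (computable_stageScans hf) (computable_stageNext hf)
    computable_stageWrites

/-- `T` passes from the configuration `C` to the configuration `D`. -/
def Reaches (T : SelfDelimitingMachine) (C D : Config) : Prop :=
  ∃ t, T.step^[t] C = D

theorem Reaches.trans {T : SelfDelimitingMachine} {C D E : Config} (h : T.Reaches C D)
    (h' : T.Reaches D E) : T.Reaches C E := by
  obtain ⟨s, rfl⟩ := h
  obtain ⟨t, rfl⟩ := h'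
  exact ⟨t + s, Function.iterate_add_apply ..⟩

theorem Reaches.head {T : SelfDelimitingMachine} {C D E : Config} (h : T.step C = D)
    (h' : T.Reaches D E) : T.Reaches C E :=
  Reaches.trans ⟨1, h⟩ h'

variable (hf : Computable₂ f)

/-- The approximations are not assumed to be monotone, and the search may stop before `s`; this is
harmless because all values found agree. -/
theorem ofStages_reaches_answer {w : List Bool} {y : Option (List Bool)} {s : ℕ}
    (hs : f w s = some y) (hy : ∀ t z, f w t = some z → z = y) (u : List Bool) {k : ℕ}
    (hk : k ≤ s) :
    ∃ s, f w s = some y ∧ (ofStages hf).Reaches ⟨Encodable.encode ((w, k, none) : StageConfig), u, []⟩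
      ⟨Encodable.encode ((w, s, none) : StageConfig), u, []⟩ := by
  induction hk using Nat.decreasingInduction with
  | self => exact ⟨s, hs, 0, rfl⟩
  | of_succ k hk ih =>
    cases h : f w k with
    | some z => exact ⟨k, hy k z h ▸ h, 0, rfl⟩
    | none =>
      obtain ⟨s', hs', hr⟩ := ih
      refine ⟨s', hs', .head ?_ hr⟩
      simp [step, ofStages, ofTransitions, stageHalts, stageScans, stageNext, stageWrites, h]

theorem ofStages_reaches_scanned {w : List Bool} {s : ℕ} (hs : f w s = some none) (b : Bool)
    (u : List Bool) :
    (ofStages hf).Reaches ⟨Encodable.encode ((w, s, none) : StageConfig), b :: u, []⟩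
      ⟨Encodable.encode ((w ++ [b], 0, none) : StageConfig), u, []⟩ := by
  refine ⟨1, ?_⟩
  simp [step, ofStages, ofTransitions, stageHalts, stageScans, stageNext, stageWrites, hs]

theorem ofStages_reaches_written {w : List Bool} {s : ℕ} (x u o : List Bool) :
    (ofStages hf).Reaches ⟨Encodable.encode ((w, s, some x) : StageConfig), u, o⟩
      ⟨Encodable.encode ((w, s, some []) : StageConfig), u, o ++ x⟩ := by
  induction x generalizing o with
  | nil => exact ⟨0, by simp⟩
  | cons b x ih =>
    refine .head (D := ⟨Encodable.encode ((w, s, some x) : StageConfig), u, o ++ [b]⟩) ?_ ?_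
    · simp [step, ofStages, ofTransitions, stageHalts, stageScans, stageNext, stageWrites]
    · simpa using ih (o ++ [b])

theorem ofStages_reaches_output {w : List Bool} {s : ℕ} {x : List Bool}
    (hs : f w s = some (some x)) (u : List Bool) :
    (ofStages hf).Reaches ⟨Encodable.encode ((w, s, none) : StageConfig), u, []⟩
      ⟨Encodable.encode ((w, s, some []) : StageConfig), u, x⟩ := by
  refine .head ?_ (ofStages_reaches_written hf x u [])
  simp [step, ofStages, ofTransitions, stageHalts, stageScans, stageNext, stageWrites, hs]

end Stages

/-- For a partial recursive function `g` that reads its argument bit by bit (the value `none` asks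
for the next bit), there is a self-delimiting machine that computes what `g` computes. -/
theorem exists_machine_of_partrec {g : List Bool →. Option (List Bool)} (hg : Partrec g) :
    ∃ T : SelfDelimitingMachine, ∀ q x, (∀ v u, v ++ u = q → u ≠ [] → none ∈ g v) →
      some x ∈ g q → T.Computes q x := by
  obtain ⟨f, hf, hfg⟩ := hg.exists_stages
  refine ⟨ofStages hf, fun q x hq hx => ?_⟩
  have key : ∀ u v, v ++ u = q → ∃ s, (ofStages hf).Reaches
      ⟨Encodable.encode ((v, 0, none) : StageConfig), u, []⟩
      ⟨Encodable.encode ((q, s, some []) : StageConfig), [], x⟩ := by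
    intro u
    induction u with
    | nil =>
      intro v hv
      rw [List.append_nil] at hv
      subst hv
      obtain ⟨s, hs⟩ := (hfg _ _).1 hx
      obtain ⟨s', hs', hr⟩ := ofStages_reaches_answer hf hs
        (fun t z hz => Part.mem_unique ((hfg _ _).2 ⟨t, hz⟩) hx) [] (Nat.zero_le s)
      exact ⟨s', hr.trans (ofStages_reaches_output hf hs' [])⟩
    | cons b u ih =>
      intro v hv
      have hn := hq v (b :: u) hv (by simp)
      obtain ⟨s, hs⟩ := (hfg _ _).1 hn
      obtain ⟨s', hs', hr⟩ := ofStages_reaches_answer hf hs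
        (fun t z hz => Part.mem_unique ((hfg _ _).2 ⟨t, hz⟩) hn) (b :: u) (Nat.zero_le s)
      obtain ⟨s'', h⟩ := ih (v ++ [b]) (by simpa using hv)
      exact ⟨s'', hr.trans ((ofStages_reaches_scanned hf hs' b u).trans h)⟩
  obtain ⟨s, t, ht⟩ := key q [] rfl
  have hrun : (ofStages hf).run q t = _ := ht
  refine ⟨t, ?_, ?_, ?_⟩ <;> rw [hrun]
  simp [ofStages, ofTransitions, stageHalts]

end SelfDelimitingMachine

/-! ### Computable lower approximations to `Ω` -/

namespace SelfDelimitingMachine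

variable (M : SelfDelimitingMachine)

/-- The configuration of `M` after `t` steps on `p` is a computable function of `p` and `t`. -/
theorem computable_run :
    Computable₂ fun (p : List Bool) (t : ℕ) =>
      ((M.run p t).internal, (M.run p t).unread, (M.run p t).output) := by
  let stp : ℕ × List Bool × List Bool → ℕ × List Bool × List Bool := fun C =>
    bif M.halts C.1 then C else bif M.scans C.1 then
      Option.casesOn C.2.1.head? C
        fun b => (M.next C.1 (some b), C.2.1.tail, C.2.2 ++ (M.writes C.1).toList)
      else (M.next C.1 none, C.2.1, C.2.2 ++ (M.writes C.1).toList)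
  have h1 : Computable fun C : ℕ × List Bool × List Bool => C.1 := Computable.fst
  have h2 : Computable fun C : ℕ × List Bool × List Bool => C.2.1 :=
    Computable.fst.comp Computable.snd
  have h3 : Computable fun C : ℕ × List Bool × List Bool => C.2.2 ++ (M.writes C.1).toList :=
    Computable.list_append.comp (Computable.snd.comp Computable.snd)
      (Primrec.optionToList.to_comp.comp (M.computable_writes.comp h1))
  have hstp : Computable stp :=
    Computable.cond (M.computable_halts.comp h1) Computable.id
      (Computable.cond (M.computable_scans.comp h1)
        (Computable.option_casesOn (Primrec.list_head?.to_comp.comp h2) Computable.id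
          ((M.computable_next.comp (h1.comp Computable.fst)
            (Computable.option_some.comp Computable.snd)).pair
            ((Primrec.list_tail.to_comp.comp (h2.comp Computable.fst)).pair
              (h3.comp Computable.fst))).to₂)
        ((M.computable_next.comp h1 (Computable.const none)).pair (h2.pair h3)))
  refine (Computable.nat_rec (f := fun q : List Bool × ℕ => q.2)
    (g := fun q => (M.start, q.1, [])) (h := fun _ r => stp r.2) Computable.snd
    ((Computable.const _).pair (Computable.fst.pair (Computable.const _)))
    (hstp.comp (Computable.snd.comp Computable.snd)).to₂).of_eq ?_
  rintro ⟨p, t⟩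
  dsimp only
  induction t with
  | zero => rfl
  | succ t ih =>
    rw [run_succ]
    change stp _ = _
    rw [ih]
    obtain ⟨i, u, o⟩ := M.run p t
    cases hh : M.halts i <;> cases hs : M.scans i <;> cases u <;> simp [stp, step, hh, hs]

theorem computable_internal : Computable₂ fun (p : List Bool) (t : ℕ) => (M.run p t).internal :=
  Computable.fst.comp M.computable_run

theorem computable_unread : Computable₂ fun (p : List Bool) (t : ℕ) => (M.run p t).unread :=
  (Computable.fst.comp Computable.snd).comp M.computable_run

theorem computable_output : Computable₂ fun (p : List Bool) (t : ℕ) => (M.run p t).output :=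
  (Computable.snd.comp Computable.snd).comp M.computable_run

/-- Whether `M` halts on `p` within `t` steps, where `k` is the code of `p` and `p` has at most `t`
bits. -/
def haltsWithin (t k : ℕ) (p : List Bool) : Bool :=
  -- The test of the code prevents counting `p` under a second number that decodes to it. The bound
  -- on the length makes the truncated subtraction in `2 ^ (t - p.length)` exact.
  (decide (Encodable.encode p = k) && decide (p.length ≤ t)) &&
    (M.halts (M.run p t).internal && decide ((M.run p t).unread = []))

/-- The contribution of `p` to the halting stage `t` if `k` is the code of `p`. -/
def addHalting (t k : ℕ) (acc : ℕ × List Bool) (p : List Bool) : ℕ × List Bool :=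
  bif M.haltsWithin t k p then (acc.1 + 2 ^ (t - p.length), acc.2 ++ (M.run p t).output) else acc

/-- The programs with a code below `k` on which `M` halts within `t` steps: the sum of their
probabilities, scaled by `2 ^ t`, and a string that is longer than all their outputs. -/
def haltingStage (t k : ℕ) : ℕ × List Bool :=
  -- The initial `[false]` makes the string strictly longer than each output, even if there is just
  -- one.
  Nat.rec (0, [false]) (fun k acc =>
    Option.casesOn (Encodable.decode (α := List Bool) k) acc (M.addHalting t k acc)) k

theorem computable_haltsWithin :
    Computable fun q : ℕ × ℕ × List Bool => M.haltsWithin q.1 q.2.1 q.2.2 := by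
  have ht : Computable fun q : ℕ × ℕ × List Bool => q.1 := Computable.fst
  have hk : Computable fun q : ℕ × ℕ × List Bool => q.2.1 := Computable.fst.comp Computable.snd
  have hp : Computable fun q : ℕ × ℕ × List Bool => q.2.2 := Computable.snd.comp Computable.snd
  refine Primrec.and.to_comp.comp (Primrec.and.to_comp.comp ?_ ?_) (Primrec.and.to_comp.comp ?_ ?_)
  · exact Primrec.eq.decide.to_comp.comp (Computable.encode.comp hp) hk
  · exact Primrec.nat_le.decide.to_comp.comp (Computable.list_length.comp hp) ht
  · exact M.computable_halts.comp (M.computable_internal.comp hp ht)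
  · exact Primrec.eq.decide.to_comp.comp (M.computable_unread.comp hp ht) (Computable.const [])

theorem primrec_two_pow : Primrec fun n : ℕ => 2 ^ n :=
  (Primrec.nat_rec₁ 1 (Primrec.nat_mul.comp (Primrec.const 2) Primrec.snd).to₂).of_eq fun n => by
    induction n with
    | zero => rfl
    | succ n ih => rw [pow_succ', ← ih]

theorem computable_addHalting : Computable fun q : (ℕ × ℕ × ℕ × List Bool) × List Bool =>
    M.addHalting q.1.1 q.1.2.1 q.1.2.2 q.2 := by
  have hk : Computable fun q : (ℕ × ℕ × ℕ × List Bool) × List Bool => q.1.2.1 :=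
    Computable.fst.comp (Computable.snd.comp Computable.fst)
  have ht : Computable fun q : (ℕ × ℕ × ℕ × List Bool) × List Bool => q.1.1 :=
    Computable.fst.comp Computable.fst
  have ha : Computable fun q : (ℕ × ℕ × ℕ × List Bool) × List Bool => q.1.2.2 :=
    Computable.snd.comp (Computable.snd.comp Computable.fst)
  have hw : Computable fun q : (ℕ × ℕ × ℕ × List Bool) × List Bool => 2 ^ (q.1.1 - q.2.length) :=
    primrec_two_pow.to_comp.comp (Primrec.nat_sub.to_comp.comp ht
      (Computable.list_length.comp Computable.snd))
  have hq : Computable fun q : (ℕ × ℕ × ℕ × List Bool) × List Bool => (q.1.1, q.1.2.1, q.2) :=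
    ht.pair (hk.pair Computable.snd)
  have hc := Computable.comp M.computable_haltsWithin hq
  exact Computable.cond hc
    (Computable.pair (Primrec.nat_add.to_comp.comp (Computable.fst.comp ha) hw)
      (Computable.list_append.comp (Computable.snd.comp ha)
        (M.computable_output.comp Computable.snd ht))) ha

theorem computable_haltingStage : Computable fun t => M.haltingStage t t := by
  have hd : Computable fun q : ℕ × ℕ × ℕ × List Bool => Encodable.decode (α := List Bool) q.2.1 :=
    Computable.decode.comp (Computable.fst.comp Computable.snd)
  have hacc : Computable fun q : ℕ × ℕ × ℕ × List Bool => q.2.2 :=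
    Computable.snd.comp Computable.snd
  have hstep : Computable₂ fun (t : ℕ) (q : ℕ × ℕ × List Bool) =>
      (Option.casesOn (Encodable.decode (α := List Bool) q.1) q.2 (M.addHalting t q.1 q.2) :
        ℕ × List Bool) :=
    Computable.option_casesOn hd hacc M.computable_addHalting
  exact Computable.nat_rec Computable.id (Computable.const (0, [false])) hstep

theorem haltingStage_spec (t k : ℕ) :
    ∃ F : Finset (List Bool),
      (∀ p, p ∈ F ↔ Encodable.encode p < k ∧ M.haltsWithin t (Encodable.encode p) p = true) ∧
      (M.haltingStage t k).1 = ∑ p ∈ F, 2 ^ (t - p.length) ∧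
      ∀ p ∈ F, (M.run p t).output.length < (M.haltingStage t k).2.length := by
  classical
  have hpos : ∀ k, 0 < (M.haltingStage t k).2.length := by
    intro k
    induction k with
    | zero => simp [haltingStage]
    | succ k ih =>
      simp only [haltingStage] at ih ⊢
      cases Encodable.decode (α := List Bool) k with
      | none => exact ih
      | some p => cases h : M.haltsWithin t k p <;> simp [addHalting, h] at ih ⊢ <;> grind
  induction k with
  | zero => exact ⟨∅, by simp, by simp [haltingStage], by simp⟩
  | succ k ih =>
    obtain ⟨F, h1, h2, h3⟩ := ih
    have hsucc : M.haltingStage t (k + 1) =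
      (Option.casesOn (Encodable.decode (α := List Bool) k) (M.haltingStage t k)
        (M.addHalting t k (M.haltingStage t k)) : ℕ × List Bool) := rfl
    by_cases hk : ∃ p : List Bool, Encodable.encode p = k ∧ M.haltsWithin t k p = true
    · obtain ⟨p, rfl, hp⟩ := hk
      rw [Encodable.encodek] at hsucc
      simp only [addHalting, hp, cond_true] at hsucc
      refine ⟨insert p F, fun q => ?_, ?_, fun q hq => ?_⟩
      · rw [Finset.mem_insert, h1, Nat.lt_succ_iff_lt_or_eq]
        constructor
        · rintro (rfl | h)
          · exact ⟨Or.inr rfl, hp⟩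
          · exact ⟨Or.inl h.1, h.2⟩
        · rintro ⟨h | h, h'⟩
          · exact Or.inr ⟨h, h'⟩
          · exact Or.inl (Encodable.encode_injective h)
      · rw [Finset.sum_insert (by rw [h1]; simp), hsucc, h2, add_comm]
      · rw [hsucc, List.length_append]
        rcases Finset.mem_insert.1 hq with rfl | hq
        · exact Nat.lt_add_of_pos_left (hpos _)
        · exact (h3 q hq).trans_le (Nat.le_add_right _ _)
    · have : M.haltingStage t (k + 1) = M.haltingStage t k := by
        rw [hsucc]
        cases hd : Encodable.decode (α := List Bool) k with
        | none => rfl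
        | some p =>
          have : M.haltsWithin t k p = false := by
            by_contra hf
            have hf : M.haltsWithin t k p = true := by simpa using hf
            refine hk ⟨p, ?_, hf⟩
            simp only [haltsWithin, Bool.and_eq_true, decide_eq_true_eq] at hf
            exact hf.1.1
          simp [addHalting, this]
      rw [this]
      refine ⟨F, fun p => ?_, h2, h3⟩
      rw [h1, Nat.lt_succ_iff_lt_or_eq]
      constructor
      · exact fun h => ⟨Or.inl h.1, h.2⟩
      · rintro ⟨h | h, h'⟩
        · exact ⟨h, h'⟩
        · exact absurd ⟨p, h, h ▸ h'⟩ hk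

theorem haltsWithin_encode {t : ℕ} {p : List Bool} :
    M.haltsWithin t (Encodable.encode p) p = true ↔
      p.length ≤ t ∧ M.halts (M.run p t).internal = true ∧ (M.run p t).unread = [] := by
  simp [haltsWithin]

/-- The programs that have halted by stage `t`. -/
theorem haltingStage_self_spec (t : ℕ) :
    ∃ F : Finset (List Bool),
      (∀ p, p ∈ F ↔ Encodable.encode p < t ∧ p.length ≤ t ∧
        M.halts (M.run p t).internal = true ∧ (M.run p t).unread = []) ∧
      ((M.haltingStage t t).1 : ℝ) = 2 ^ t * ∑ p ∈ F, (1 / 2 : ℝ) ^ p.length ∧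
      ∀ p ∈ F, (M.run p t).output.length < (M.haltingStage t t).2.length := by
  obtain ⟨F, h1, h2, h3⟩ := M.haltingStage_spec t t
  simp only [haltsWithin_encode] at h1
  refine ⟨F, h1, ?_, h3⟩
  rw [h2, Finset.mul_sum]
  push_cast
  refine Finset.sum_congr rfl fun p hp => ?_
  rw [pow_sub₀ _ two_ne_zero ((h1 p).1 hp).2.1, one_div, inv_pow]

/-! ### From the digits of `Ω` to a complex string -/

/-- The sums of the probabilities of the programs that have halted come close to `Ω`. -/
theorem exists_haltingStage_gt {a N : ℕ} (ha : (a : ℝ) ≤ M.haltingProbability * 2 ^ N) :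
    ∃ t, a * 2 ^ t < (M.haltingStage t t).1 * 2 ^ N + 2 ^ t := by
  -- The slack of one unit `2^(-N)` is needed: if `Ω = a / 2^N`, finite sums need not reach this
  -- value.
  obtain ⟨F, hF, hlt⟩ := M.exists_lt_sum (M.haltingProbability - (1 / 2) ^ N)
    (sub_lt_self _ (by positivity))
  have hex : ∀ p ∈ F, ∃ t, Encodable.encode p < t ∧ p.length ≤ t ∧
      M.halts (M.run p t).internal = true ∧ (M.run p t).unread = [] := by
    intro p hp
    obtain ⟨_, t, ht, hu, -⟩ := hF p hp
    refine ⟨t + Encodable.encode p + 1 + p.length, by omega, by omega, ?_⟩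
    rw [M.run_eq_of_halts ht (by omega)]
    exact ⟨ht, hu⟩
  choose! τ hτ using hex
  refine ⟨F.sup τ, ?_⟩
  set t := F.sup τ
  obtain ⟨G, hG, hW, -⟩ := M.haltingStage_self_spec t
  have hsub : F ⊆ G := by
    intro p hp
    have hle : τ p ≤ t := Finset.le_sup hp
    obtain ⟨h1, h2, h3, h4⟩ := hτ p hp
    rw [hG, M.run_eq_of_halts h3 hle]
    exact ⟨h1.trans_le hle, h2.trans hle, h3, h4⟩
  have hsum := Finset.sum_le_sum_of_subset_of_nonneg hsub
    fun p _ _ => (by positivity : (0 : ℝ) ≤ (1 / 2) ^ p.length)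
  set σ := ∑ p ∈ G, (1 / 2 : ℝ) ^ p.length
  have h2 : (2 : ℝ) ^ N * (1 / 2) ^ N = 1 := by rw [← mul_pow]; norm_num
  have : (a : ℝ) < σ * 2 ^ N + 1 := by
    have hN : (0 : ℝ) < 2 ^ N := by positivity
    nlinarith [mul_lt_mul_of_pos_right (hlt.trans_le hsum) hN]
  have : (a : ℝ) * 2 ^ t < (M.haltingStage t t).1 * 2 ^ N + 2 ^ t := by
    have ht : (0 : ℝ) < 2 ^ t := by positivity
    rw [hW]
    nlinarith [mul_lt_mul_of_pos_right this ht]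
  exact_mod_cast this

/-- Once the sum of the probabilities of the programs that have halted is close to `Ω`, no short
program computes the string of the halting stage. -/
theorem le_length_of_computes_haltingStage {a N t : ℕ}
    (ha : M.haltingProbability * 2 ^ N < a + 1)
    (ht : a * 2 ^ t < (M.haltingStage t t).1 * 2 ^ N + 2 ^ t) {p : List Bool}
    (hp : M.Computes p (M.haltingStage t t).2) : N ≤ p.length := by
  classical
  by_contra! hlen
  obtain ⟨G, hG, hW, hlong⟩ := M.haltingStage_self_spec t
  have hGh : ∀ q ∈ G, M.HaltsOn q := fun q hq =>
    ⟨_, t, ((hG q).1 hq).2.2.1, ((hG q).1 hq).2.2.2, rfl⟩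
  have ht' : (a : ℝ) * 2 ^ t < (M.haltingStage t t).1 * 2 ^ N + 2 ^ t := by exact_mod_cast ht
  -- If `p` has halted by stage `t`, its output is too short. Otherwise it adds at least `2 / 2^N`
  -- to a sum above `(a - 1) / 2^N`, contrary to `Ω < (a + 1) / 2^N`.
  by_cases hpG : p ∈ G
  · have : M.Computes p (M.run p t).output :=
      ⟨t, ((hG p).1 hpG).2.2.1, ((hG p).1 hpG).2.2.2, rfl⟩
    have h := hlong p hpG
    rw [hp.output_unique this] at h
    exact lt_irrefl _ h
  · have hle := M.sum_le_haltingProbability (insert p G) fun q hq => by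
      rcases Finset.mem_insert.1 hq with rfl | hq
      · exact ⟨_, hp⟩
      · exact hGh q hq
    rw [Finset.sum_insert hpG] at hle
    set σ := ∑ p ∈ G, (1 / 2 : ℝ) ^ p.length
    have hpow : 2 ≤ (1 / 2 : ℝ) ^ p.length * 2 ^ N := by
      obtain ⟨k, rfl⟩ := Nat.exists_eq_add_of_lt hlen
      rw [add_assoc, pow_add, ← mul_assoc, ← mul_pow]
      norm_num
      rw [pow_succ]
      nlinarith [one_le_pow₀ (M₀ := ℝ) (a := 2) (n := k) (by norm_num)]
    have hN : (0 : ℝ) < 2 ^ N := by positivity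
    have ht0 : (0 : ℝ) < 2 ^ t := by positivity
    have h1 : (a : ℝ) < σ * 2 ^ N + 1 := by
      rw [hW] at ht'
      refine lt_of_mul_lt_mul_right (a := (2 : ℝ) ^ t) ?_ ht0.le
      linarith
    nlinarith [mul_le_mul_of_nonneg_right hle hN.le]

end SelfDelimitingMachine

/-! ### Certificates for bits of `Ω` -/

theorem primrec_selfDelim : Primrec selfDelim := by
  have h : Primrec fun x : List Bool => List.replicate x.length true :=
    (Primrec.list_map (Primrec.list_range.comp Primrec.list_length)
      (Primrec.const true).to₂).of_eq fun x => by simp [List.map_const']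
  exact Primrec.list_append.comp h (Primrec.list_cons.comp (Primrec.const false) Primrec.id)

/-- A claim about initial bits of `Ω`, with evidence: for each bit, nothing, or a value together
with the theorems that are enumerated before the one that asserts this value. -/
abbrev BitCertificate := List (Option (Fin 2 × List (List Bool)))

namespace BitCertificate

/-- The number of bits with a claimed value. -/
def count (d : BitCertificate) : ℕ := (d.filterMap id).length

theorem count_cons_none (d : BitCertificate) : count (none :: d) = count d := rfl

theorem count_cons_some (e : Fin 2 × List (List Bool)) (d : BitCertificate) :
    count (some e :: d) = count d + 1 := rfl

theorem primrec_count : Primrec count :=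
  Primrec.list_length.comp (Primrec.listFilterMap Primrec.id Primrec.snd)

/-- The numeral with leading part `a` that continues with the bits of the certificate, those for
which it claims nothing being taken from a list. -/
def fill (a : ℕ) (d : BitCertificate) (rest : List Bool) : ℕ :=
  (d.foldl (fun (c : ℕ × List Bool) e => (Option.casesOn e
    -- The default of `headI` plays no role when the list has as many bits as the certificate has
    -- gaps.
    (2 * c.1 + c.2.headI.toNat, c.2.tail) fun e => (2 * c.1 + e.1.val, c.2) : ℕ × List Bool))
    (a, rest)).1

theorem fill_cons_none (a : ℕ) (d : BitCertificate) (b : Bool) (rest : List Bool) :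
    fill a (none :: d) (b :: rest) = fill (2 * a + b.toNat) d rest := rfl

theorem fill_cons_some (a : ℕ) (d : BitCertificate) (e : Fin 2 × List (List Bool))
    (rest : List Bool) : fill a (some e :: d) rest = fill (2 * a + e.1.val) d rest := rfl

theorem primrec_fill (a : ℕ) : Primrec₂ (fill a) := by
  have hc : Primrec fun q : (BitCertificate × List Bool) × (ℕ × List Bool) ×
      Option (Fin 2 × List (List Bool)) => 2 * q.2.1.1 :=
    Primrec.nat_mul.comp (Primrec.const 2)
      (Primrec.fst.comp (Primrec.fst.comp Primrec.snd))
  have hr : Primrec fun q : (BitCertificate × List Bool) × (ℕ × List Bool) ×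
      Option (Fin 2 × List (List Bool)) => q.2.1.2 :=
    Primrec.snd.comp (Primrec.fst.comp Primrec.snd)
  have hnone : Primrec fun q : (BitCertificate × List Bool) × (ℕ × List Bool) ×
      Option (Fin 2 × List (List Bool)) => (2 * q.2.1.1 + q.2.1.2.headI.toNat, q.2.1.2.tail) :=
    (Primrec.nat_add.comp hc ((Primrec.dom_finite Bool.toNat).comp
      (Primrec.list_headI.comp hr))).pair (Primrec.list_tail.comp hr)
  have hval : Primrec fun q : ((BitCertificate × List Bool) × (ℕ × List Bool) ×
      Option (Fin 2 × List (List Bool))) × Fin 2 × List (List Bool) => q.2.1.val :=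
    Primrec.fin_val.comp (Primrec.fst.comp Primrec.snd)
  have hsome : Primrec₂ fun (q : (BitCertificate × List Bool) × (ℕ × List Bool) ×
      Option (Fin 2 × List (List Bool))) (e : Fin 2 × List (List Bool)) =>
      (2 * q.2.1.1 + e.1.val, q.2.1.2) :=
    (Primrec.nat_add.comp (hc.comp Primrec.fst) hval).pair (hr.comp Primrec.fst)
  have hstep := Primrec.option_casesOn (Primrec.snd.comp Primrec.snd) hnone hsome
  exact Primrec.fst.comp (Primrec.list_foldl Primrec.fst
    ((Primrec.const a).pair Primrec.snd) hstep.to₂)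

variable (assertion : ℕ × Fin 2 → List Bool)

/-- The output at the moment when an assertion has been enumerated after other theorems. -/
def enumeration (n : ℕ) (e : Fin 2 × List (List Bool)) : List Bool :=
  e.2.flatMap selfDelim ++ selfDelim (assertion (n, e.1))

/-- Whether the evidence for the value of bit `n` agrees with the output `o`. -/
def entryHolds (o : List Bool) (n : ℕ) (e : Option (Fin 2 × List (List Bool))) : Bool :=
  Option.casesOn e true fun e =>
    decide (enumeration assertion n e = o.take (enumeration assertion n e).length)

/-- Whether the evidence in the certificate agrees with the output `o`. -/
def holds (o : List Bool) (d : BitCertificate) : Bool :=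
  Nat.rec true (fun n ok => ok && entryHolds assertion o n (d[n]?.getD none)) d.length

theorem entryHolds_some (o : List Bool) (n : ℕ) (e : Fin 2 × List (List Bool)) :
    entryHolds assertion o n (some e) = true ↔ enumeration assertion n e <+: o := by
  simp [entryHolds, List.prefix_iff_eq_take]

/-- Evidence has the same form as the prefixes in `Enumerates`, so it is compared with the output
directly and no decoder for theorems is needed. Gaps pass the check. -/
theorem holds_iff (o : List Bool) (d : BitCertificate) :
    holds assertion o d = true ↔
      ∀ n e, d[n]? = some (some e) → enumeration assertion n e <+: o := by
  have key : ∀ k : ℕ, (Nat.rec true (fun n ok => ok && entryHolds assertion o n (d[n]?.getD none))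
      k : Bool) = true ↔ ∀ n < k, entryHolds assertion o n (d[n]?.getD none) = true := by
    intro k
    induction k with
    | zero => simp
    | succ k ih =>
      simp only [Bool.and_eq_true, ih, Nat.lt_succ_iff_lt_or_eq]
      grind
  rw [holds, key]
  constructor
  · intro h n e hn
    have := h n (List.getElem?_eq_some_iff.1 hn).1
    rw [hn] at this
    exact (entryHolds_some ..).1 this
  · intro h n _
    rcases hd : d[n]? with _ | _ | e
    · rfl
    · rfl
    · exact (entryHolds_some ..).2 (h n e hd)

variable {assertion}

theorem computable_holds (ha : Computable assertion) : Computable₂ (holds assertion) := by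
  have he : Computable fun q : ((List Bool × BitCertificate) × ℕ × Bool) ×
      Fin 2 × List (List Bool) => enumeration assertion q.1.2.1 q.2 := by
    have h1 : Computable fun q : ((List Bool × BitCertificate) × ℕ × Bool) ×
        Fin 2 × List (List Bool) => (q.1.2.1, q.2.1) :=
      (Computable.fst.comp (Computable.snd.comp Computable.fst)).pair
        (Computable.fst.comp Computable.snd)
    have h2 : Computable fun q : ((List Bool × BitCertificate) × ℕ × Bool) ×
        Fin 2 × List (List Bool) => q.2.2.flatMap selfDelim :=
      (Primrec.list_flatMap (Primrec.snd.comp Primrec.snd)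
        (primrec_selfDelim.comp Primrec.snd).to₂).to_comp
    exact Computable.list_append.comp h2 (primrec_selfDelim.to_comp.comp (ha.comp h1))
  have ho : Computable fun q : ((List Bool × BitCertificate) × ℕ × Bool) ×
      Fin 2 × List (List Bool) => q.1.1.1 :=
    Computable.fst.comp (Computable.fst.comp Computable.fst)
  have hsome : Computable₂ fun (q : (List Bool × BitCertificate) × ℕ × Bool)
      (e : Fin 2 × List (List Bool)) => decide (enumeration assertion q.2.1 e =
        q.1.1.take (enumeration assertion q.2.1 e).length) :=
    Primrec.eq.decide.to_comp.comp he
      (Primrec.list_take.to_comp.comp (Computable.list_length.comp he) ho)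
  have hget : Computable fun q : (List Bool × BitCertificate) × ℕ × Bool =>
      q.1.2[q.2.1]?.getD none :=
    Computable.option_getD (Computable.list_getElem?.comp (Computable.snd.comp Computable.fst)
      (Computable.fst.comp Computable.snd)) (Computable.const none)
  have hentry : Computable fun q : (List Bool × BitCertificate) × ℕ × Bool =>
      entryHolds assertion q.1.1 q.2.1 (q.1.2[q.2.1]?.getD none) :=
    Computable.option_casesOn hget (Computable.const true) hsome
  have hstep : Computable₂ fun (q : List Bool × BitCertificate) (r : ℕ × Bool) =>
      (r.2 && entryHolds assertion q.1 r.1 (q.2[r.1]?.getD none)) :=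
    Primrec.and.to_comp.comp (Computable.snd.comp Computable.snd) hentry
  exact Computable.nat_rec (Computable.list_length.comp Computable.snd) (Computable.const true)
    hstep

end BitCertificate

/-! ### The compressing algorithm and its computability -/

namespace SelfDelimitingMachine

variable (M : SelfDelimitingMachine) (assertion : ℕ × Fin 2 → List Bool)

/-- The certificate that step `s` of the work on `v` yields, if any. It has to claim at least
`2 * j` more bits than have been scanned. -/
def certificateAt (j : ℕ) (v : List Bool) (s : ℕ) : Option BitCertificate :=
  -- `s` is both the number of steps and, through `unpair`, the code of the candidate, so one
  -- unbounded search covers both.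
  (Encodable.decode (α := BitCertificate) s.unpair.1).bind fun d =>
    bif BitCertificate.holds assertion (M.run v s).output d &&
      -- With the unread bits on the right, the test is not affected by bits appended to `v`.
      decide (v.length + 2 * j ≤ d.count + (M.run v s).unread.length) then some d else none

/-- Whether `M` asks for a further bit after `s` steps on `v`. -/
def asksAt (v : List Bool) (s : ℕ) : Bool :=
  (!M.halts (M.run v s).internal && M.scans (M.run v s).internal) &&
    decide ((M.run v s).unread = [])

theorem asksAt_iff (v : List Bool) (s : ℕ) :
    M.asksAt v s = true ↔ M.Overshoots (M.run v s) := by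
  simp [asksAt, Overshoots, and_assoc]

theorem certificateAt_eq_some {j : ℕ} {v : List Bool} {s : ℕ} {d : BitCertificate} :
    M.certificateAt assertion j v s = some d ↔
      Encodable.decode s.unpair.1 = some d ∧
      BitCertificate.holds assertion (M.run v s).output d = true ∧
      v.length + 2 * j ≤ d.count + (M.run v s).unread.length := by
  rw [certificateAt, Option.bind_eq_some_iff]
  constructor
  · rintro ⟨e, he, h⟩
    rw [Bool.cond_eq_ite] at h
    split_ifs at h with hc
    rw [Option.some_inj] at h
    subst h
    simp only [Bool.and_eq_true, decide_eq_true_eq] at hc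
    exact ⟨he, hc⟩
  · rintro ⟨h1, h2, h3⟩
    exact ⟨d, h1, by simp [h2, h3]⟩

/-- Whether the string `w` of the form `1 ^ j 0 v` can be judged after `s` steps of the work on
`v`. -/
def judgedAt (w : List Bool) (s : ℕ) : Bool :=
  -- Equality means that no `false` has been read, so that `j` is still unknown.
  decide (w.idxOf false = w.length) ||
    ((M.certificateAt assertion (w.idxOf false) (w.drop (w.idxOf false + 1)) s).isSome ||
      M.asksAt (w.drop (w.idxOf false + 1)) s)

/-- The integer part of `2 ^ N * Ω`, and `N`, as obtained from the string `w` if that has been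
judged after `s` steps. The number `a` is the integer part of `Ω`. -/
def approximationAt (a : ℕ) (w : List Bool) (s : ℕ) : Option (ℕ × ℕ) :=
  bif decide (w.idxOf false = w.length) then none else
    (M.certificateAt assertion (w.idxOf false) (w.drop (w.idxOf false + 1)) s).bind fun d =>
      -- What the simulated machine has left unread fills the gaps of the certificate; if it does
      -- not suffice, a further bit is requested.
      bif decide (d.length ≤ d.count + (M.run (w.drop (w.idxOf false + 1)) s).unread.length) then
        some (d.fill a (M.run (w.drop (w.idxOf false + 1)) s).unread, d.length)
      else none

/-- Whether the sum of the probabilities of the programs that have halted by stage `t` is close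
to `a / 2 ^ N`, where `q = (a, N)`. -/
def closeAt (q : ℕ × ℕ) (t : ℕ) : Bool :=
  decide (q.1 * 2 ^ t < (M.haltingStage t t).1 * 2 ^ q.2 + 2 ^ t)

/-- A string that no program with fewer than `N` bits computes, obtained from the integer part of
`2 ^ N * Ω`. -/
def complexString (q : ℕ × ℕ) : Part (List Bool) :=
  (Nat.rfind fun t => Part.some (M.closeAt q t)).map fun t => (M.haltingStage t t).2

/-- The partial function from programs to complex strings; the value `none` asks for a further bit
of the program. -/
def complexStringOfProgram (a : ℕ) (w : List Bool) : Part (Option (List Bool)) :=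
  (Nat.rfind fun s => Part.some (M.judgedAt assertion w s)).bind fun s =>
    Option.casesOn (M.approximationAt assertion a w s) (Part.some none)
      fun q => (M.complexString q).map some

variable {assertion}

theorem computable_certificateAt (ha : Computable assertion) :
    Computable fun q : ℕ × List Bool × ℕ => M.certificateAt assertion q.1 q.2.1 q.2.2 := by
  have hd : Computable fun q : ℕ × List Bool × ℕ =>
      Encodable.decode (α := BitCertificate) q.2.2.unpair.1 :=
    Computable.decode.comp
      (Computable.fst.comp (Computable.unpair.comp (Computable.snd.comp Computable.snd)))
  have hv : Computable fun q : (ℕ × List Bool × ℕ) × BitCertificate => q.1.2.1 :=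
    Computable.fst.comp (Computable.snd.comp Computable.fst)
  have hs : Computable fun q : (ℕ × List Bool × ℕ) × BitCertificate => q.1.2.2 :=
    Computable.snd.comp (Computable.snd.comp Computable.fst)
  have hj : Computable fun q : (ℕ × List Bool × ℕ) × BitCertificate => 2 * q.1.1 :=
    Primrec.nat_mul.to_comp.comp (Computable.const 2) (Computable.fst.comp Computable.fst)
  have hh : Computable fun q : (ℕ × List Bool × ℕ) × BitCertificate =>
      BitCertificate.holds assertion (M.run q.1.2.1 q.1.2.2).output q.2 :=
    (BitCertificate.computable_holds ha).comp (M.computable_output.comp hv hs) Computable.snd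
  have hl : Computable fun q : (ℕ × List Bool × ℕ) × BitCertificate =>
      decide (q.1.2.1.length + 2 * q.1.1 ≤ q.2.count + (M.run q.1.2.1 q.1.2.2).unread.length) :=
    Primrec.nat_le.decide.to_comp.comp
      (Primrec.nat_add.to_comp.comp (Computable.list_length.comp hv) hj)
      (Primrec.nat_add.to_comp.comp (BitCertificate.primrec_count.to_comp.comp Computable.snd)
        (Computable.list_length.comp (M.computable_unread.comp hv hs)))
  exact Computable.option_bind hd (Computable.cond (Primrec.and.to_comp.comp hh hl)
    (Computable.option_some.comp Computable.snd) (Computable.const none))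

theorem computable_asksAt : Computable₂ M.asksAt := by
  have hi : Computable fun q : List Bool × ℕ => (M.run q.1 q.2).internal := M.computable_internal
  have hu : Computable fun q : List Bool × ℕ => (M.run q.1 q.2).unread := M.computable_unread
  exact Primrec.and.to_comp.comp
    (Primrec.and.to_comp.comp (Primrec.not.to_comp.comp (M.computable_halts.comp hi))
      (M.computable_scans.comp hi))
    (Primrec.eq.decide.to_comp.comp hu (Computable.const []))

theorem computable_idxOf_false : Computable fun q : List Bool × ℕ => q.1.idxOf false :=
  (Primrec.list_idxOf.comp (Primrec.const false) Primrec.fst).to_comp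

theorem computable_drop_idxOf_false :
    Computable fun q : List Bool × ℕ => q.1.drop (q.1.idxOf false + 1) :=
  Primrec.list_drop.to_comp.comp (Computable.succ.comp computable_idxOf_false) Computable.fst

theorem computable_idxOf_false_eq_length :
    Computable fun q : List Bool × ℕ => decide (q.1.idxOf false = q.1.length) :=
  Primrec.eq.decide.to_comp.comp computable_idxOf_false (Computable.list_length.comp Computable.fst)

theorem computable_certificateAt_drop (ha : Computable assertion) :
    Computable fun q : List Bool × ℕ => M.certificateAt assertion (q.1.idxOf false)
      (q.1.drop (q.1.idxOf false + 1)) q.2 := by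
  have h : Computable fun q : List Bool × ℕ =>
      (q.1.idxOf false, q.1.drop (q.1.idxOf false + 1), q.2) :=
    computable_idxOf_false.pair (computable_drop_idxOf_false.pair Computable.snd)
  have hc := Computable.comp (M.computable_certificateAt ha) h
  exact hc

theorem computable_judgedAt (ha : Computable assertion) : Computable₂ (M.judgedAt assertion) := by
  have h1 := Primrec.option_isSome.to_comp.comp (M.computable_certificateAt_drop ha)
  have h2 : Computable fun q : List Bool × ℕ => M.asksAt (q.1.drop (q.1.idxOf false + 1)) q.2 :=
    M.computable_asksAt.comp computable_drop_idxOf_false Computable.snd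
  exact Primrec.or.to_comp.comp computable_idxOf_false_eq_length (Primrec.or.to_comp.comp h1 h2)

theorem computable_approximationAt (ha : Computable assertion) (a : ℕ) :
    Computable₂ (M.approximationAt assertion a) := by
  have hu : Computable fun q : (List Bool × ℕ) × BitCertificate =>
      (M.run (q.1.1.drop (q.1.1.idxOf false + 1)) q.1.2).unread :=
    M.computable_unread.comp (computable_drop_idxOf_false.comp Computable.fst)
      (Computable.snd.comp Computable.fst)
  have hl : Computable fun q : (List Bool × ℕ) × BitCertificate => decide (q.2.length ≤
      q.2.count + (M.run (q.1.1.drop (q.1.1.idxOf false + 1)) q.1.2).unread.length) :=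
    Primrec.nat_le.decide.to_comp.comp (Computable.list_length.comp Computable.snd)
      (Primrec.nat_add.to_comp.comp (BitCertificate.primrec_count.to_comp.comp Computable.snd)
        (Computable.list_length.comp hu))
  have hf : Computable fun q : (List Bool × ℕ) × BitCertificate =>
      (q.2.fill a (M.run (q.1.1.drop (q.1.1.idxOf false + 1)) q.1.2).unread, q.2.length) :=
    ((BitCertificate.primrec_fill a).to_comp.comp Computable.snd hu).pair
      (Computable.list_length.comp Computable.snd)
  exact Computable.cond computable_idxOf_false_eq_length (Computable.const none)
    (Computable.option_bind (M.computable_certificateAt_drop ha)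
      (Computable.cond hl (Computable.option_some.comp hf) (Computable.const none)))

theorem partrec_complexString : Partrec M.complexString := by
  have hp : Computable fun q : (ℕ × ℕ) × ℕ => 2 ^ q.2 :=
    primrec_two_pow.to_comp.comp Computable.snd
  have hN : Computable fun q : (ℕ × ℕ) × ℕ => 2 ^ q.1.2 :=
    primrec_two_pow.to_comp.comp (Computable.snd.comp Computable.fst)
  have hs : Computable fun q : (ℕ × ℕ) × ℕ => (M.haltingStage q.2 q.2).1 :=
    Computable.fst.comp (M.computable_haltingStage.comp Computable.snd)
  have hc : Computable₂ M.closeAt :=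
    Primrec.nat_lt.decide.to_comp.comp
      (Primrec.nat_mul.to_comp.comp (Computable.fst.comp Computable.fst) hp)
      (Primrec.nat_add.to_comp.comp (Primrec.nat_mul.to_comp.comp hs hN) hp)
  have hx : Computable₂ fun (_ : ℕ × ℕ) (t : ℕ) => (M.haltingStage t t).2 :=
    Computable.snd.comp (M.computable_haltingStage.comp Computable.snd)
  exact (Partrec.rfind hc.partrec₂).map hx

theorem partrec_complexStringOfProgram (ha : Computable assertion) (a : ℕ) :
    Partrec (M.complexStringOfProgram assertion a) := by
  have hsome : Partrec₂ fun (_ : List Bool × ℕ) (q : ℕ × ℕ) => (M.complexString q).map some :=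
    (M.partrec_complexString.comp Computable.snd).map (Computable.option_some.comp Computable.snd)
  have h : Partrec₂ fun (w : List Bool) (s : ℕ) =>
      (Option.casesOn (M.approximationAt assertion a w s) (Part.some none)
        fun q => (M.complexString q).map some : Part (Option (List Bool))) :=
    Partrec.optionCasesOn_right (M.computable_approximationAt ha a) (Computable.const none) hsome
  exact (Partrec.rfind (M.computable_judgedAt ha).partrec₂).bind h

end SelfDelimitingMachine

/-! ### Behaviour of the algorithm on its programs -/

namespace SelfDelimitingMachine

variable (M : SelfDelimitingMachine) (assertion : ℕ × Fin 2 → List Bool)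

/-- The lower bound on `Ω` makes the search for a close stage succeed, and the upper bound makes the
string of that stage complex. -/
theorem exists_mem_complexString {a N : ℕ} (h₁ : (a : ℝ) ≤ M.haltingProbability * 2 ^ N)
    (h₂ : M.haltingProbability * 2 ^ N < a + 1) :
    ∃ x ∈ M.complexString (a, N), ∀ p, M.Computes p x → N ≤ p.length := by
  obtain ⟨t₀, ht₀⟩ := M.exists_haltingStage_gt h₁
  obtain ⟨t, ht, -⟩ := Nat.rfind_min' (p := M.closeAt (a, N)) (m := t₀) (by simpa [closeAt] using ht₀)
  refine ⟨_, Part.mem_map _ ht, fun p hp => M.le_length_of_computes_haltingStage h₂ ?_ hp⟩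
  simpa [closeAt] using Nat.rfind_spec ht

variable {M assertion}

theorem mem_rfind_judgedAt {w : List Bool} {s : ℕ} (hs : M.judgedAt assertion w s = true)
    (hmin : ∀ t < s, M.judgedAt assertion w t = false) :
    s ∈ Nat.rfind fun s => Part.some (M.judgedAt assertion w s) := by
  refine Nat.mem_rfind.2 ⟨by simp [hs], fun {t} ht => by simp [hmin t ht]⟩

theorem none_mem_complexStringOfProgram {a : ℕ} {w : List Bool} {s : ℕ}
    (hs : M.judgedAt assertion w s = true) (hmin : ∀ t < s, M.judgedAt assertion w t = false)
    (h : M.approximationAt assertion a w s = none) :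
    none ∈ M.complexStringOfProgram assertion a w :=
  Part.mem_bind (mem_rfind_judgedAt hs hmin) (by simp [h])

theorem some_mem_complexStringOfProgram {a : ℕ} {w : List Bool} {s : ℕ} {q : ℕ × ℕ}
    {x : List Bool} (hs : M.judgedAt assertion w s = true)
    (hmin : ∀ t < s, M.judgedAt assertion w t = false)
    (h : M.approximationAt assertion a w s = some q) (hx : x ∈ M.complexString q) :
    some x ∈ M.complexStringOfProgram assertion a w :=
  Part.mem_bind (mem_rfind_judgedAt hs hmin) (by rw [h]; exact Part.mem_map _ hx)

theorem none_mem_complexStringOfProgram_replicate (a i : ℕ) :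
    none ∈ M.complexStringOfProgram assertion a (List.replicate i true) := by
  have h : (List.replicate i true).idxOf false = (List.replicate i true).length :=
    List.idxOf_eq_length (by simp)
  refine none_mem_complexStringOfProgram (s := 0) ?_ (by simp) ?_
  · simp only [judgedAt, h, decide_true, Bool.true_or]
  · simp only [approximationAt, h, decide_true, cond_true]

theorem idxOf_false_replicate (j : ℕ) (v : List Bool) :
    (List.replicate j true ++ false :: v).idxOf false = j := by
  rw [List.idxOf_append_of_notMem (by simp)]
  simp

theorem drop_replicate (j : ℕ) (v : List Bool) :
    (List.replicate j true ++ false :: v).drop (j + 1) = v := by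
  rw [List.drop_append]
  simp

theorem judgedAt_replicate (j : ℕ) (v : List Bool) (s : ℕ) :
    M.judgedAt assertion (List.replicate j true ++ false :: v) s =
      ((M.certificateAt assertion j v s).isSome || M.asksAt v s) := by
  rw [judgedAt, idxOf_false_replicate, drop_replicate]
  simp

theorem approximationAt_replicate (a j : ℕ) (v : List Bool) (s : ℕ) :
    M.approximationAt assertion a (List.replicate j true ++ false :: v) s =
      (M.certificateAt assertion j v s).bind fun d =>
        bif decide (d.length ≤ d.count + (M.run v s).unread.length) then
          some (d.fill a (M.run v s).unread, d.length) else none := by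
  rw [approximationAt, idxOf_false_replicate, drop_replicate]
  simp

/-- As long as `v` suffices, the output does not depend on what follows, and `u` lengthens both
sides of the inequality equally. -/
theorem certificateAt_append (j : ℕ) {v : List Bool} {s : ℕ}
    (h : ∀ t < s, ¬ M.Overshoots (M.run v t)) (u : List Bool) :
    M.certificateAt assertion j (v ++ u) s = M.certificateAt assertion j v s := by
  have : ∀ d : BitCertificate,
      ((v ++ u).length + 2 * j ≤ d.count + ((M.run v s).unread ++ u).length ↔
        v.length + 2 * j ≤ d.count + (M.run v s).unread.length) := by
    intro d
    simp only [List.length_append]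
    omega
  simp only [certificateAt, M.run_append h, this]

theorem asksAt_append_eq_false {v : List Bool} {s : ℕ}
    (h : ∀ t < s, ¬ M.Overshoots (M.run v t)) {t : ℕ} (ht : t < s) (u : List Bool) :
    M.asksAt (v ++ u) t = false := by
  rw [Bool.eq_false_iff, ne_eq, asksAt_iff, M.run_append fun k hk => h k (hk.trans ht)]
  rintro ⟨h1, h2, h3⟩
  exact h t ht ⟨h1, h2, (List.append_eq_nil_iff.1 h3).1⟩

/-! ### The programs `1^j 0 v rest`, with `v` the part scanned when the first certificate appears -/

section Program

variable {j s : ℕ} {v : List Bool} {d : BitCertificate}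
  (hask : ∀ t < s, ¬ M.Overshoots (M.run v t)) (hread : (M.run v s).unread = [])
  (hcert : M.certificateAt assertion j v s = some d)
  (hmin : ∀ t < s, M.certificateAt assertion j v t = none)

include hask hread hmin in
-- All of `v` is scanned by step `s`, so `v'` proves too short before `s`. Until then it behaves
-- like `v`, which has no certificate yet.
theorem none_mem_complexStringOfProgram_of_append (a : ℕ) {v' b : List Bool} (hv : v' ++ b = v)
    (hb : b ≠ []) :
    none ∈ M.complexStringOfProgram assertion a (List.replicate j true ++ false :: v') := by
  classical
  have hex : ∃ t, t < s ∧ M.Overshoots (M.run v' t) := by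
    by_contra! hno
    subst hv
    rw [M.run_append hno] at hread
    exact hb (List.append_eq_nil_iff.1 hread).2
  obtain ⟨hlt, ho⟩ := Nat.find_spec hex
  have hno : ∀ t < Nat.find hex, ¬ M.Overshoots (M.run v' t) := fun t ht ho' =>
    Nat.find_min hex ht ⟨ht.trans hlt, ho'⟩
  have hc : ∀ t ≤ Nat.find hex, M.certificateAt assertion j v' t = none := by
    intro t ht
    rw [← certificateAt_append j (fun k hk => hno k (hk.trans_le ht)) b, hv]
    exact hmin t (ht.trans_lt hlt)
  refine none_mem_complexStringOfProgram (s := Nat.find hex) ?_ (fun t ht => ?_) ?_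
  · rw [judgedAt_replicate, (M.asksAt_iff ..).2 ho, Bool.or_true]
  · rw [judgedAt_replicate, hc t ht.le, Bool.eq_false_iff.2 (mt (M.asksAt_iff ..).1 (hno t ht))]
    rfl
  · rw [approximationAt_replicate, hc _ le_rfl]
    rfl

include hask hcert in
theorem judgedAt_append (rest : List Bool) :
    M.judgedAt assertion (List.replicate j true ++ false :: (v ++ rest)) s = true := by
  rw [judgedAt_replicate, certificateAt_append j hask, hcert]
  rfl

include hask hmin in
theorem judgedAt_append_of_lt (rest : List Bool) {t : ℕ} (ht : t < s) :
    M.judgedAt assertion (List.replicate j true ++ false :: (v ++ rest)) t = false := by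
  rw [judgedAt_replicate, certificateAt_append j fun k hk => hask k (hk.trans ht), hmin t ht,
    asksAt_append_eq_false hask ht]
  rfl

include hask hread hcert in
theorem approximationAt_append (a : ℕ) (rest : List Bool) :
    M.approximationAt assertion a (List.replicate j true ++ false :: (v ++ rest)) s =
      if d.length ≤ d.count + rest.length then some (d.fill a rest, d.length) else none := by
  rw [approximationAt_replicate, certificateAt_append j hask, hcert, M.run_append hask, hread,
    Option.bind_some, List.nil_append, Bool.cond_decide]

include hask hread hcert hmin in
/-- All proper prefixes of the program `1 ^ j 0 v rest` ask for a further bit. -/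
theorem none_mem_complexStringOfProgram_of_proper (a : ℕ) {rest : List Bool}
    (hrest : d.count + rest.length = d.length) {w u : List Bool}
    (hw : w ++ u = List.replicate j true ++ false :: (v ++ rest)) (hu : u ≠ []) :
    none ∈ M.complexStringOfProgram assertion a w := by
  have hrep : ∀ w : List Bool, w <+: List.replicate j true →
      none ∈ M.complexStringOfProgram assertion a w := fun w hw => by
    rw [List.prefix_replicate_iff.1 hw |>.2]
    exact none_mem_complexStringOfProgram_replicate ..
  rcases List.append_eq_append_iff.1 hw with ⟨k, hk, -⟩ | ⟨k, rfl, hk⟩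
  · exact hrep w ⟨k, hk.symm⟩
  rcases k with _ | ⟨b, k⟩
  · rw [List.append_nil]
    exact none_mem_complexStringOfProgram_replicate ..
  rw [List.cons_append, List.cons.injEq] at hk
  obtain ⟨rfl, hk⟩ := hk
  rcases List.append_eq_append_iff.1 hk with ⟨l, rfl, hl⟩ | ⟨l, hl, hl'⟩
  · refine none_mem_complexStringOfProgram (s := s) (judgedAt_append hask hcert l)
      (fun t => judgedAt_append_of_lt hask hmin l) ?_
    rw [approximationAt_append hask hread hcert, if_neg]
    have := List.length_pos_iff.2 hu
    rw [hl, List.length_append] at hrest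
    omega
  · rcases l with _ | ⟨b, l⟩
    -- Here `w` ends right after `v`. The certificate takes precedence over any request of the
    -- simulated machine, and a bit is needed because a gap is left.
    · rw [List.append_nil] at hl
      rw [List.nil_append] at hl'
      subst hl hl'
      rw [← List.append_nil v]
      refine none_mem_complexStringOfProgram (s := s) (judgedAt_append hask hcert [])
        (fun t => judgedAt_append_of_lt hask hmin []) ?_
      rw [approximationAt_append hask hread hcert, if_neg]
      have := List.length_pos_iff.2 hu
      simp only [List.length_nil]
      omega
    · exact none_mem_complexStringOfProgram_of_append hask hread hmin a hl.symm (by simp)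

include hask hread hcert hmin in
theorem some_mem_complexStringOfProgram_append (a : ℕ) {rest : List Bool}
    (hrest : d.count + rest.length = d.length) {x : List Bool}
    (hx : x ∈ M.complexString (d.fill a rest, d.length)) :
    some x ∈ M.complexStringOfProgram assertion a
      (List.replicate j true ++ false :: (v ++ rest)) :=
  some_mem_complexStringOfProgram (judgedAt_append hask hcert rest)
    (fun _ => judgedAt_append_of_lt hask hmin rest)
    (by rw [approximationAt_append hask hread hcert, if_pos hrest.ge]) hx

end Program

/-! ### Recovering the digits of `Ω` from a certificate and the missing bits -/

variable (M)

/-- Doubling appends one binary digit, since `Real.digits` is the left-hand floor modulo 2. The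
integer part of `Ω` need not vanish. -/
theorem floor_mul_two_pow_succ (n : ℕ) :
    ⌊M.haltingProbability * 2 ^ (n + 1)⌋₊ =
      2 * ⌊M.haltingProbability * 2 ^ n⌋₊ + (M.omegaBit n).val := by
  have h1 : (M.omegaBit n).val = ⌊M.haltingProbability * 2 ^ (n + 1)⌋₊ % 2 := by
    simp [omegaBit, Real.digits]
  have h2 : ⌊M.haltingProbability * 2 ^ n⌋₊ = ⌊M.haltingProbability * 2 ^ (n + 1)⌋₊ / 2 := by
    rw [← Nat.floor_div_ofNat]
    congr 1
    rw [pow_succ]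
    ring
  rw [h1, h2]
  omega

/-- The bits of `Ω` from position `n` on for which a certificate claims no value. -/
noncomputable def missingBits : ℕ → BitCertificate → List Bool
  | _, [] => []
  | n, none :: d => decide (M.omegaBit n = 1) :: missingBits (n + 1) d
  | n, some _ :: d => missingBits (n + 1) d

theorem count_add_length_missingBits (n : ℕ) (d : BitCertificate) :
    d.count + (M.missingBits n d).length = d.length := by
  induction d generalizing n with
  | nil => rfl
  | cons e d ih =>
    have := ih (n + 1)
    cases e with
    | none =>
      rw [BitCertificate.count_cons_none, missingBits, List.length_cons, List.length_cons]
      omega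
    | some e =>
      rw [BitCertificate.count_cons_some, missingBits, List.length_cons]
      omega

/-- Each entry supplies the next true digit: a claimed one is true by `hd`, any other comes from the
list of missing bits. -/
theorem fill_missingBits (n : ℕ) (d : BitCertificate)
    (hd : ∀ i e, d[i]? = some (some e) → M.omegaBit (n + i) = e.1) :
    d.fill ⌊M.haltingProbability * 2 ^ n⌋₊ (M.missingBits n d) =
      ⌊M.haltingProbability * 2 ^ (n + d.length)⌋₊ := by
  induction d generalizing n with
  | nil => rfl
  | cons e d ih =>
    have h := ih (n + 1) fun i e he => by
      rw [add_assoc, add_comm 1]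
      exact hd (i + 1) e (by simpa using he)
    rw [floor_mul_two_pow_succ, add_right_comm] at h
    rw [List.length_cons, ← add_assoc, ← h]
    cases e with
    | none =>
      have hb : (decide (M.omegaBit n = 1)).toNat = (M.omegaBit n).val := by
        generalize M.omegaBit n = b
        revert b
        decide
      rw [missingBits, BitCertificate.fill_cons_none, hb]
    | some e =>
      rw [missingBits, BitCertificate.fill_cons_some, ← hd 0 e rfl, add_zero]

/-! ### Compression and the bound on the number of determined bits -/

variable {M}

/-- If a theory determines enough bits of `Ω`, then some step of its enumeration yields a
certificate. -/
theorem Enumerates.exists_certificateAt {p : List Bool} {S : Set (List Bool)}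
    (hp : M.Enumerates p S) {j : ℕ}
    (hS : ((p.length + 2 * j : ℕ) : ℕ∞) ≤ {n | ∃ b, assertion (n, b) ∈ S}.encard) :
    ∃ s, (M.certificateAt assertion j p s).isSome = true := by
  classical
  -- A certificate is finite, so only as many positions as needed are selected; infinitely many may
  -- be determined.
  obtain ⟨F, hFS, hF⟩ := Set.exists_subset_encard_eq hS
  have hfin : F.Finite := Set.finite_of_encard_eq_coe hF
  lift F to Finset ℕ using hfin
  rw [Set.encard_coe_eq_coe_finsetCard, Nat.cast_inj] at hF
  have hex : ∀ n ∈ F, ∃ e : Fin 2 × List (List Bool), ∃ t,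
      BitCertificate.enumeration assertion n e <+: (M.run p t).output := by
    intro n hn
    obtain ⟨b, hb⟩ := hFS hn
    obtain ⟨t, l, h⟩ := (hp.2.2 _).1 hb
    exact ⟨(b, l), t, h⟩
  choose! e τ hτ using hex
  let d : BitCertificate :=
    (List.range (F.sup id + 1)).map fun n => if n ∈ F then some (e n) else none
  have hcount : d.count = p.length + 2 * j := by
    have : F = (Finset.range (F.sup id + 1)).filter (· ∈ F) := by
      ext n
      simp only [Finset.mem_filter, Finset.mem_range, iff_and_self]
      exact fun hn => Nat.lt_succ_of_le (Finset.le_sup (f := id) hn)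
    rw [← hF, this, ← Nat.count_eq_card_filter_range, BitCertificate.count, List.filterMap_map,
      List.length_filterMap_eq_countP, Nat.count]
    congr 1
    ext n
    by_cases hn : n ∈ F <;> simp [hn]
  -- A pair is at least its second component, so after this many steps all the evidence has been
  -- written.
  refine ⟨Nat.pair (Encodable.encode d) (F.sup τ), Option.isSome_iff_exists.2 ⟨d, ?_⟩⟩
  rw [certificateAt_eq_some]
  refine ⟨by simp, ?_, by omega⟩
  rw [BitCertificate.holds_iff]
  intro n e' hn
  obtain ⟨hF', rfl⟩ : n ∈ F ∧ e n = e' := by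
    simp only [d, List.getElem?_map, Option.map_eq_some_iff] at hn
    obtain ⟨m, hm, h⟩ := hn
    obtain ⟨hm', rfl⟩ := List.getElem?_eq_some_iff.1 hm
    rw [List.getElem_range] at h
    split_ifs at h with hF'
    exact ⟨hF', Option.some_inj.1 h⟩
  exact (hτ n hF').trans (M.output_prefix p ((Finset.le_sup hF').trans (Nat.right_le_pair _ _)))

/-- A machine `T`, such that an enumeration of a sound theory that determines too many bits of the
halting probability of `M` gives rise to a program for `T` for a string that is more complex for
`M`. -/
theorem exists_machine_compressing (M : SelfDelimitingMachine) {assertion : ℕ × Fin 2 → List Bool}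
    (ha : Computable assertion) :
    ∃ T : SelfDelimitingMachine, ∀ (j : ℕ) (p : List Bool) (S : Set (List Bool)),
      M.Enumerates p S → (∀ n b, assertion (n, b) ∈ S → M.omegaBit n = b) →
      ((p.length + 2 * j : ℕ) : ℕ∞) ≤ {n | ∃ b, assertion (n, b) ∈ S}.encard →
      ∃ q x, T.Computes q x ∧ ∀ p, M.Computes p x → q.length + j ≤ p.length + 1 := by
  classical
  -- The integer part of `Ω` is built into `T`, because the digits after the binary point do not
  -- provide it.
  obtain ⟨T, hT⟩ := exists_machine_of_partrec
    (M.partrec_complexStringOfProgram ha ⌊M.haltingProbability⌋₊)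
  refine ⟨T, fun j p S hp hsound hS => ?_⟩
  have hex := hp.exists_certificateAt hS
  obtain ⟨d, hd⟩ := Option.isSome_iff_exists.1 (Nat.find_spec hex)
  have hmin : ∀ t < Nat.find hex, M.certificateAt assertion j p t = none := fun t ht => by
    simpa using Nat.find_min hex ht
  generalize Nat.find hex = s at hd hmin
  -- At step `s` the program `p` need not have been scanned completely. Only the scanned part `v` is
  -- used: `T` takes the bits after it as missing bits of `Ω`.
  obtain ⟨v, hv⟩ := M.unread_suffix p (Nat.zero_le s)
  rw [run_zero] at hv
  have hask : ∀ t < s, ¬ M.Overshoots (M.run v t) :=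
    M.not_overshoots_of_append (u := (M.run p s).unread) (by rw [hv]; exact fun t _ => hp.2.1 t)
      (by rw [hv])
  have hrun := M.run_append hask (M.run p s).unread
  rw [hv] at hrun
  have hread : (M.run v s).unread = [] := by
    have := congrArg (fun C => C.unread.length) hrun
    simp only [List.length_append] at this
    exact List.length_eq_zero_iff.1 (by omega)
  have hcert : M.certificateAt assertion j v s = some d := by
    rw [← hd, ← certificateAt_append j hask (M.run p s).unread, hv]
  have hmin' : ∀ t < s, M.certificateAt assertion j v t = none := fun t ht => by
    rw [← hmin t ht, ← certificateAt_append j (fun k hk => hask k (hk.trans ht))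
      (M.run p s).unread, hv]
  have hlen := count_add_length_missingBits M 0 d
  have hfill : d.fill ⌊M.haltingProbability⌋₊ (M.missingBits 0 d) =
      ⌊M.haltingProbability * 2 ^ d.length⌋₊ := by
    have hholds := ((certificateAt_eq_some ..).1 hd).2.1
    rw [BitCertificate.holds_iff] at hholds
    have := M.fill_missingBits 0 d fun i e he => by
      rw [zero_add]
      exact hsound i e.1 ((hp.2.2 _).2 ⟨s, e.2, hholds i e he⟩)
    simpa using this
  obtain ⟨x, hx, hcomplex⟩ := M.exists_mem_complexString (N := d.length)
    (Nat.floor_le (mul_nonneg M.haltingProbability_nonneg (by positivity)))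
    (Nat.lt_floor_add_one _)
  rw [← hfill] at hx
  refine ⟨List.replicate j true ++ false :: (v ++ M.missingBits 0 d), x,
    hT _ x (fun w u hw hu => none_mem_complexStringOfProgram_of_proper hask hread hcert hmin' _
      hlen hw hu)
      (some_mem_complexStringOfProgram_append hask hread hcert hmin' _ hlen hx),
    fun q hq => ?_⟩
  -- With `N = d.length`, the program has `j + 1 + |v| + (N - d.count)` bits, where `d.count ≥ |v| +
  -- 2j` and `N ≤ |q|`.
  have h1 := hcomplex q hq
  have h2 := ((certificateAt_eq_some ..).1 hcert).2.2
  rw [hread] at h2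
  simp only [List.length_append, List.length_replicate, List.length_cons, List.length_nil] at h2 ⊢
  omega

end SelfDelimitingMachine

theorem mainTheorem5 (U : SelfDelimitingMachine) (hU : U.IsUniversal)
    (assertion : ℕ × Fin 2 → List Bool) (h_computable : Computable assertion)
    (h_injective : Function.Injective assertion) :
    ∃ c : ℕ, ∀ A : FormalAxiomaticTheory, A.SoundForOmega U assertion →
      (A.determinedBits assertion).encard ≤ A.complexity U + c := by
  obtain ⟨T, hT⟩ := U.exists_machine_compressing h_computable
  obtain ⟨r, hr⟩ := hU T
  -- With `j = |r| + 2` the constant is `2j`. Compression applied to the program `r q` for `U` would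
  -- give `j ≤ |r| + 1`.
  refine ⟨2 * (r.length + 2), fun A hA => ?_⟩
  -- The bound is shown for every enumerating program; if there is none, the infimum is `⊤`.
  rw [FormalAxiomaticTheory.complexity, ENat.iInf_add]
  refine le_iInf fun p => ?_
  rw [ENat.iInf_add]
  refine le_iInf fun hp => ?_
  by_contra! hlt
  obtain ⟨q, x, hq, hx⟩ := hT (r.length + 2) p A.theorems hp hA
    (by rw [Nat.cast_add]; exact hlt.le)
  have := hx _ (((hr q).1 x).2 hq)
  rw [List.length_append] at this
  omega
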